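/- Let $d$ be a nonnegative integer and let $\mu$ be a probability distribution on $\mathbb{R}^{d\times d}$ with compact support $\mathcal M = \operatorname{supp}\mu$. Assume that the singular part $\mu_s$ of $\mu$ with respect to Lebesgue measure on $\mathbb{R}^{d\times d}$ consists of finitely many point masses, i.e. $\mu_s=\sum_{i=1}^{n} c_i\,\delta_{M_i}$ for some $n\ge 0$, positive numbers $c_1,\dots,c_n$ and matrices $M_1,\dots,M_n$. Let $A$ be a random matrix with distribution $\mu$, let $A^{\otimes p}$ denote its $p$-th Kronecker power (a $d^p\times d^p$ matrix), let $\rho$ denote the spectral radius of a square matrix (the largest modulus of its complex eigenvalues), and, for any norm $\|\cdot\|$ on $\mathbb{R}^{d\times d}$, let $$\hat\rho(\mathcal M)=\limsup_{k\to\infty}\ \sup_{A_1,\dots,A_k\in\mathcal M}\|A_k\cdots A_1\|^{1/k}$$ be the joint spectral radius of $\mathcal M$. Then all expectations $E[A^{\otimes p}]$ exist, $\hat\rho(\mathcal M)$ is finite, and $$\hat\rho(\mathcal M)=\limsup_{p\to\infty}\ \bigl(\rho(E[A^{\otimes p}])\bigr)^{1/p}.$$ -/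

import Mathlib

open MeasureTheory Filter
open scoped ENNReal NNReal Kronecker

/-- The product `σ`-algebra on `ℝ^{d×d}`; it is the Borel `σ`-algebra. -/
instance matrixMeasurableSpace (d : ℕ) : MeasurableSpace (Matrix (Fin d) (Fin d) ℝ) :=
  inferInstanceAs (MeasurableSpace (Fin d → Fin d → ℝ))

instance matrixBorelSpace (d : ℕ) : BorelSpace (Matrix (Fin d) (Fin d) ℝ) :=
  inferInstanceAs (BorelSpace (Fin d → Fin d → ℝ))

/-- Lebesgue measure on `ℝ^{d×d}`, i.e. the product over the `d²` entries of Lebesgue measure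
on `ℝ`. It is the measure that `volume` denotes. -/
noncomputable instance matrixMeasureSpace (d : ℕ) :
    MeasureSpace (Matrix (Fin d) (Fin d) ℝ) where
  volume := (volume : Measure (Fin d → Fin d → ℝ))

/-- The Kronecker power `M^{⊗p}`, a `d^p × d^p` matrix: `M^{⊗(p+1)} = M^{⊗p} ⊗ M`, where the pairs
of indices are enumerated in lexicographic order. The power `M^{⊗0}` is the `1 × 1` identity. -/
def kronPow {d : ℕ} (M : Matrix (Fin d) (Fin d) ℝ) :
    (p : ℕ) → Matrix (Fin (d ^ p)) (Fin (d ^ p)) ℝ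
  | 0 => 1
  | p + 1 => Matrix.reindex (finProdFinEquiv.trans (finCongr (pow_succ d p).symm))
      (finProdFinEquiv.trans (finCongr (pow_succ d p).symm)) (kronPow M p ⊗ₖ M)

/-- The expectation `E[A^{⊗p}]` (taken entry by entry) for a random matrix `A` with law `μ`. -/
noncomputable def expKronPow {d : ℕ} (μ : Measure (Matrix (Fin d) (Fin d) ℝ)) (p : ℕ) :
    Matrix (Fin (d ^ p)) (Fin (d ^ p)) ℝ :=
  Matrix.of fun i j => ∫ A, kronPow A p i j ∂μ

/-- The spectral radius of a real square matrix: the largest modulus of its complex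
eigenvalues. -/
noncomputable def matrixSpectralRadius {n : ℕ} (M : Matrix (Fin n) (Fin n) ℝ) : ℝ≥0∞ :=
  spectralRadius ℂ (M.map ((↑) : ℝ → ℂ))

/-- The joint spectral radius of a set `S` of matrices, computed with the norm `N`:
`limsup_{k → ∞} sup_{A₁, …, A_k ∈ S} N(A_k ⋯ A₁)^{1/k}`, as an element of `[0, ∞]`.
(The tuple `A` lists the factors from left to right; all tuples are allowed.) -/
noncomputable def jointSpectralRadius {d : ℕ} (N : Seminorm ℝ (Matrix (Fin d) (Fin d) ℝ))
    (S : Set (Matrix (Fin d) (Fin d) ℝ)) : ℝ≥0∞ :=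
  limsup (fun k : ℕ => ⨆ (A : Fin k → Matrix (Fin d) (Fin d) ℝ) (_ : ∀ i, A i ∈ S),
    ENNReal.ofReal (N (List.ofFn A).prod) ^ (1 / (k : ℝ))) atTop

/-! Kronecker powers turn moments into matrix powers: by independence `E[A^{⊗p}]^k =
E[(A₁⋯A_k)^{⊗p}]`, whose trace is `E[tr(A₁⋯A_k)^p]`.

If the joint spectral radius is below `r`, products on the support are `O(r^k)`. So for fixed `p`
the entries of `E[A^{⊗p}]^k` are `O(r^{pk})`, which forces `ρ(E[A^{⊗p}]) ≤ r^p`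
(`matrixSpectralRadius_expKronPow_le`).

Conversely, let `ρ(E[A^{⊗p}]) ≤ q^p` for large `p`. For even `p` the `p`-th moment of the trace is
at most `d^p q^{pk}`. Letting `p → ∞` bounds the trace almost surely, hence by continuity on the
whole support (`abs_trace_prod_le`). Norms are then recovered from traces, as in the Berger–Wang
theorem (`exists_norm_prod_le_of_trace_le`): in the algebra generated by the support the radical of
the trace form is a nilpotent ideal; modulo it a product is determined by its traces against
finitely many words, so it is `O(q^k)`; and a nilpotent ideal does not change the exponential rate.
-/

/-! ### Nilpotency of the radical of a trace form -/

section TraceForm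

variable {A : Type*} [Ring A] [Algebra ℝ A]

/-- In a finite-dimensional algebra, an element orthogonal to everything under a form that detects
idempotents is nilpotent. -/
theorem isNilpotent_of_forall_form_eq_zero [FiniteDimensional ℝ A] (τ : A →ₗ[ℝ] ℝ)
    (hidem : ∀ e : A, IsIdempotentElem e → τ e = 0 → e = 0) {x : A}
    (hx : ∀ y, τ (x * y) = 0) : IsNilpotent x := by
  have hint : IsIntegral ℝ x := Algebra.IsIntegral.isIntegral x
  obtain ⟨q, hq, hnd⟩ := (minpoly ℝ x).exists_eq_pow_rootMultiplicity_mul_and_not_dvd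
    (minpoly.ne_zero hint) 0
  set n := (minpoly ℝ x).rootMultiplicity 0
  simp only [map_zero, sub_zero] at hq hnd
  -- The exponent is `n + 1`, not `n`, so that the idempotent below is a multiple of `x` even when
  -- `n = 0`.
  have hcop : IsCoprime (Polynomial.X ^ (n + 1)) q :=
    IsCoprime.pow_left ((Polynomial.irreducible_X.coprime_iff_not_dvd).2 hnd)
  obtain ⟨u, v, huv⟩ := hcop
  have hxq : x ^ (n + 1) * Polynomial.aeval x q = 0 := by
    have h := minpoly.aeval ℝ x
    rw [hq] at h
    simp only [map_mul, map_pow, Polynomial.aeval_X] at h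
    rw [pow_succ', mul_assoc, h, mul_zero]
  have h1 := congrArg (Polynomial.aeval x) huv
  simp only [map_add, map_mul, map_pow, Polynomial.aeval_X, map_one] at h1
  have hcx : ∀ w : Polynomial ℝ, Polynomial.aeval x w * x ^ (n + 1)
      = x ^ (n + 1) * Polynomial.aeval x w := fun w =>
    by simpa using congrArg (Polynomial.aeval x) (mul_comm w (Polynomial.X ^ (n + 1)))
  set U := Polynomial.aeval x u
  set V := Polynomial.aeval x v
  set Q := Polynomial.aeval x q
  -- This is the Fitting idempotent of `x`, the projection onto the part where `x` is invertible.
  have he0 : U * x ^ (n + 1) = 0 := by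
    apply hidem
    · have h2 : (U * x ^ (n + 1)) * (V * Q) = 0 := by
        rw [mul_assoc, ← mul_assoc _ V, ← hcx v, mul_assoc, hxq, mul_zero, mul_zero]
      have h3 : U * x ^ (n + 1) * (U * x ^ (n + 1) + V * Q) = U * x ^ (n + 1) := by
        rw [h1, mul_one]
      rwa [mul_add, h2, add_zero] at h3
    · rw [hcx, pow_succ', mul_assoc]
      exact hx _
  refine ⟨n + 1, ?_⟩
  have h4 : V * Q = 1 := by rwa [he0, zero_add] at h1
  calc x ^ (n + 1) = x ^ (n + 1) * (V * Q) := by rw [h4, mul_one]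
    _ = 0 := by rw [← mul_assoc, ← hcx, mul_assoc, hxq, mul_zero]

/-- The radical of the form `(x, y) ↦ τ (x * y)` of a tracial functional `τ`. -/
def formRadical (τ : A →ₗ[ℝ] ℝ) (hτ : ∀ x y, τ (x * y) = τ (y * x)) : Ideal A where
  carrier := {x | ∀ y, τ (x * y) = 0}
  add_mem' := fun ha hb y => by rw [add_mul, map_add, ha y, hb y, add_zero]
  zero_mem' := fun y => by rw [zero_mul, map_zero]
  smul_mem' := fun c x hx y => by
    rw [smul_eq_mul, mul_assoc, hτ, mul_assoc]
    exact hx _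

theorem mem_formRadical {τ : A →ₗ[ℝ] ℝ} {hτ : ∀ x y, τ (x * y) = τ (y * x)} {x : A} :
    x ∈ formRadical τ hτ ↔ ∀ y, τ (x * y) = 0 := Iff.rfl

instance formRadical_isTwoSided (τ : A →ₗ[ℝ] ℝ) (hτ : ∀ x y, τ (x * y) = τ (y * x)) :
    (formRadical τ hτ).IsTwoSided :=
  ⟨fun b ha y => by rw [mul_assoc]; exact ha (b * y)⟩

/-- Every `y * x` with `x` in the radical is nilpotent, so `y * x + 1` is a unit and `x` lies in the
Jacobson radical, which is nilpotent in an Artinian ring. -/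
theorem isNilpotent_formRadical [FiniteDimensional ℝ A] (τ : A →ₗ[ℝ] ℝ)
    (hτ : ∀ x y, τ (x * y) = τ (y * x))
    (hidem : ∀ e : A, IsIdempotentElem e → τ e = 0 → e = 0) :
    IsNilpotent (formRadical τ hτ) := by
  have : IsArtinianRing A := IsArtinianRing.of_finite ℝ A
  have hle : formRadical τ hτ ≤ Ring.jacobson A := by
    intro x hx
    rw [← Ideal.jacobson_bot, Ideal.mem_jacobson_iff]
    intro y
    have hyx : IsNilpotent (y * x) :=
      isNilpotent_of_forall_form_eq_zero τ hidem (Ideal.mul_mem_left _ y hx)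
    obtain ⟨u, hu⟩ := hyx.isUnit_add_one
    refine ⟨↑u⁻¹, ?_⟩
    have : (↑u⁻¹ : A) * (y * x + 1) = 1 := by rw [← hu]; simp
    rw [mul_add, mul_one] at this
    rw [mul_assoc, this, sub_self]
    exact zero_mem _
  obtain ⟨n, hn⟩ := IsSemiprimaryRing.isNilpotent (R := A)
  exact ⟨n, le_bot_iff.1 ((Ideal.pow_right_mono hle n).trans hn.le)⟩

end TraceForm

/-! ### Growth of products modulo a nilpotent ideal -/

section Growth

variable {A : Type*} [NormedRing A]

/-- Products of elements which are `a`-bounded modulo a nilpotent ideal grow at most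
like `(2 * a) ^ m`. -/
theorem exists_norm_prod_le_of_nilpotent (I : Ideal A) [I.IsTwoSided] (hI : IsNilpotent I) (T : Set A)
    {a b : ℝ} (ha : 0 < a)
    (hT : ∀ x ∈ T, ∃ y, x - y ∈ I ∧ ‖y‖ ≤ a ∧ ‖x - y‖ ≤ b) :
    ∃ G : ℝ, 0 ≤ G ∧ ∀ l : List A, (∀ x ∈ l, x ∈ T) → ∀ z : A,
      ‖l.prod * z‖ ≤ G * (2 * a) ^ l.length * ‖z‖ := by
  obtain ⟨n, hn⟩ := hI
  have key : ∀ j, j ≤ n → ∃ G : ℝ, 0 ≤ G ∧ ∀ l : List A, (∀ x ∈ l, x ∈ T) → ∀ z ∈ I ^ j,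
      ‖l.prod * z‖ ≤ G * (2 * a) ^ l.length * ‖z‖ := by
    intro j hj
    induction hj using Nat.decreasingInduction with
    | self =>
      refine ⟨0, le_rfl, fun l _ z hz => ?_⟩
      rw [hn] at hz
      have : z = 0 := hz
      simp [this]
    | of_succ j hj ih =>
      obtain ⟨G', hG', ih⟩ := ih
      -- Write the last factor as `y + (x - y)`: `y * z` stays in `I ^ j`, while `(x - y) * z` drops
      -- into `I ^ (j + 1)`. As `G' * b ≤ G * a`, each part costs at most `G * a`, whence the rate
      -- `2 * a`.
      refine ⟨max 1 (G' * b / a), by positivity, fun l => ?_⟩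
      set G := max 1 (G' * b / a) with hG
      have hG1 : 1 ≤ G := le_max_left _ _
      have hGa : G' * b ≤ G * a := by
        rw [← div_le_iff₀ ha]; exact le_max_right _ _
      induction l using List.reverseRecOn with
      | nil =>
        intro _ z _
        simpa using le_mul_of_one_le_left (norm_nonneg z) hG1
      | append_singleton l x ihl =>
        intro hl z hz
        have hl' : ∀ y ∈ l, y ∈ T := fun y hy => hl y (by simp [hy])
        obtain ⟨y, hxy, hy, hr⟩ := hT x (hl x (by simp))
        have h1 := ihl hl' (y * z) (Ideal.mul_mem_left _ y hz)
        have h2 := ih l hl' ((x - y) * z) (by rw [Ideal.IsTwoSided.pow_succ]; exact Ideal.mul_mem_mul hxy hz)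
        have hsplit : (l ++ [x]).prod * z = l.prod * (y * z) + l.prod * ((x - y) * z) := by
          simp only [List.prod_append, List.prod_cons, List.prod_nil, mul_one]
          noncomm_ring
        have hp : (0 : ℝ) ≤ (2 * a) ^ l.length := by positivity
        calc ‖(l ++ [x]).prod * z‖ ≤ ‖l.prod * (y * z)‖ + ‖l.prod * ((x - y) * z)‖ := by
              rw [hsplit]; exact norm_add_le _ _
          _ ≤ G * (2 * a) ^ l.length * (a * ‖z‖) + G' * (2 * a) ^ l.length * (b * ‖z‖) := by
              refine add_le_add (h1.trans ?_) (h2.trans ?_)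
              · refine mul_le_mul_of_nonneg_left ((norm_mul_le _ _).trans ?_) (by positivity)
                gcongr
              · refine mul_le_mul_of_nonneg_left ((norm_mul_le _ _).trans ?_) (by positivity)
                gcongr
          _ = (2 * a) ^ l.length * ‖z‖ * (G * a + G' * b) := by ring
          _ ≤ (2 * a) ^ l.length * ‖z‖ * (G * a + G * a) := by gcongr
          _ = G * (2 * a) ^ (l ++ [x]).length * ‖z‖ := by
              rw [List.length_append, List.length_singleton, pow_succ]; ring
  obtain ⟨G, hG, h⟩ := key 0 (Nat.zero_le _)
  exact ⟨G, hG, fun l hl z => h l hl z (by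
    rw [Submodule.pow_zero, Ideal.one_eq_top]; trivial)⟩

end Growth

/-! ### From traces to norms -/

section TraceGrowth

variable {A : Type*} [NormedRing A] [NormedAlgebra ℝ A] [FiniteDimensional ℝ A]

/-- If the form values of products grow like `L ^ k`, then so do the products themselves, modulo
the radical of the form. -/
theorem exists_norm_le_mod_formRadical (τ : A →ₗ[ℝ] ℝ)
    (hτ : ∀ x y, τ (x * y) = τ (y * x)) (S : Set A) (hS : Algebra.adjoin ℝ S = ⊤) {D L : ℝ}
    (hL : 0 < L) (hD : 0 ≤ D)
    (htr : ∀ l : List A, (∀ x ∈ l, x ∈ S) → |τ l.prod| ≤ D * L ^ l.length) :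
    ∃ C : ℝ, 0 < C ∧ ∀ l : List A, (∀ x ∈ l, x ∈ S) →
      ∃ y, l.prod - y ∈ formRadical τ hτ ∧ ‖y‖ ≤ C * L ^ l.length := by
  have hspan : Submodule.span ℝ (Submonoid.closure S : Set A) = ⊤ := by
    rw [← Algebra.adjoin_eq_span, hS]; rfl
  have hfg : (Submodule.span ℝ (Submonoid.closure S : Set A)).FG := by
    rw [hspan]; exact Module.Finite.fg_top
  obtain ⟨B, hBS, hB⟩ := (Submodule.fg_span_iff_fg_span_finset_subset _).1 hfg
  rw [hspan] at hB
  choose w hwS hw using fun b : B => Submonoid.exists_list_of_mem_closure (hBS b.2)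
  -- Words in `S` span, so testing against the finitely many words in `B` detects the radical; on a
  -- product each test value is again `τ` of a product.
  let Φ : A →ₗ[ℝ] (B → ℝ) := LinearMap.pi fun b => τ ∘ₗ LinearMap.mulRight ℝ (b : A)
  have hΦ : ∀ x b, Φ x b = τ (x * b) := fun _ _ => rfl
  have hker : ∀ x, Φ x = 0 → x ∈ formRadical τ hτ := by
    intro x hx
    rw [mem_formRadical]
    intro y
    have hle : (⊤ : Submodule ℝ A) ≤ LinearMap.ker (τ ∘ₗ LinearMap.mulLeft ℝ x) := by
      rw [hB, Submodule.span_le]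
      intro b hb
      exact congrFun hx ⟨b, hb⟩
    exact hle (Submodule.mem_top (x := y))
  -- A linear section of `Φ`, bounded by finite dimension, picks the small representative modulo the
  -- radical.
  obtain ⟨g, hg⟩ := Φ.rangeRestrict.exists_rightInverse_of_surjective Φ.range_rangeRestrict
  have hΦg : ∀ x, Φ (g (Φ.rangeRestrict x)) = Φ x := fun x =>
    congrArg Subtype.val (LinearMap.congr_fun hg (Φ.rangeRestrict x))
  let g' := LinearMap.toContinuousLinearMap g
  obtain ⟨W, hW⟩ : ∃ W : ℝ, ∀ b : B, L ^ (w b).length ≤ W := by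
    obtain ⟨W, hW⟩ := (Set.finite_range fun b : B => L ^ (w b).length).bddAbove
    exact ⟨W, fun b => hW ⟨b, rfl⟩⟩
  refine ⟨‖g'‖ * (D * |W|) + 1, by positivity, fun l hl => ⟨g (Φ.rangeRestrict l.prod), ?_, ?_⟩⟩
  · apply hker
    rw [map_sub, hΦg, sub_self]
  · have hn : ‖Φ.rangeRestrict l.prod‖ ≤ D * |W| * L ^ l.length := by
      change ‖Φ l.prod‖ ≤ _
      rw [pi_norm_le_iff_of_nonneg (by positivity)]
      intro b
      rw [hΦ, ← hw b, ← List.prod_append, Real.norm_eq_abs]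
      refine (htr _ fun x hx => ?_).trans ?_
      · rcases List.mem_append.1 hx with h | h
        exacts [hl x h, hwS b x h]
      · rw [List.length_append, pow_add]
        calc D * (L ^ l.length * L ^ (w b).length) ≤ D * (L ^ l.length * |W|) := by
              gcongr; exact (hW b).trans (le_abs_self W)
          _ = _ := by ring
    calc ‖g (Φ.rangeRestrict l.prod)‖ = ‖g' (Φ.rangeRestrict l.prod)‖ := rfl
      _ ≤ ‖g'‖ * (D * |W| * L ^ l.length) := (g'.le_opNorm _).trans (by gcongr)
      _ ≤ (‖g'‖ * (D * |W|) + 1) * L ^ l.length := by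
          have : 0 ≤ L ^ l.length := by positivity
          linarith

theorem norm_list_prod_le_pow {A : Type*} [NormedRing A] {K : ℝ} (hK : 1 ≤ K) (h1 : ‖(1 : A)‖ ≤ K) (l : List A)
    (hl : ∀ x ∈ l, ‖x‖ ≤ K) : ‖l.prod‖ ≤ K ^ (l.length + 1) := by
  induction l with
  | nil => simpa using h1
  | cons x l ih =>
    rw [List.prod_cons, List.length_cons, pow_succ' K (l.length + 1)]
    refine (norm_mul_le _ _).trans ?_
    have := ih fun y hy => hl y (by simp [hy])
    have := hl x (by simp)
    gcongr

/-- A list splits into blocks of length `k`, followed by a shorter list. -/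
theorem List.exists_flatten_append {α : Type*} (k : ℕ) (hk : 0 < k) (l : List α) :
    ∃ (m : List (List α)) (t : List α), l = m.flatten ++ t ∧ (∀ b ∈ m, b.length = k) ∧
      t.length < k := by
  induction hn : l.length using Nat.strong_induction_on generalizing l with
  | _ n ih =>
    by_cases h : l.length < k
    · exact ⟨[], l, by simp, by simp, h⟩
    · obtain ⟨m, t, hmt, hm, ht⟩ := ih (l.drop k).length (by simp; omega) (l.drop k) rfl
      refine ⟨l.take k :: m, t, ?_, ?_, ht⟩
      · rw [List.flatten_cons, List.append_assoc, ← hmt, List.take_append_drop]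
      · intro b hb
        rcases List.mem_cons.1 hb with rfl | hb
        · rw [List.length_take]; omega
        · exact hm b hb

/-- Cut a word into blocks of length `k`. Modulo the radical each block has norm at most `C * L ^
k`, so `m` blocks grow like `(2 * C * L ^ k) ^ m`; for large `k` the gap between `L` and `r` absorbs
`2 * C`. -/
theorem exists_norm_prod_le_of_adjoin_eq_top (τ : A →ₗ[ℝ] ℝ)
    (hτ : ∀ x y, τ (x * y) = τ (y * x))
    (hidem : ∀ e : A, IsIdempotentElem e → τ e = 0 → e = 0) (S : Set A)
    (hS : Algebra.adjoin ℝ S = ⊤) {D L K r : ℝ}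
    (hL : 0 < L) (hD : 0 ≤ D) (hK : ∀ x ∈ S, ‖x‖ ≤ K)
    (htr : ∀ l : List A, (∀ x ∈ l, x ∈ S) → |τ l.prod| ≤ D * L ^ l.length) (hr : L < r) :
    ∃ G : ℝ, ∀ l : List A, (∀ x ∈ l, x ∈ S) → ‖l.prod‖ ≤ G * r ^ l.length := by
  obtain ⟨C, hC, h⟩ := exists_norm_le_mod_formRadical τ hτ S hS hL hD htr
  have hr0 : 0 < r := hL.trans hr
  obtain ⟨k, hk⟩ := ((tendsto_pow_atTop_atTop_of_one_lt ((one_lt_div hL).2 hr)).eventually_ge_atTop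
    (2 * C)).and (eventually_gt_atTop 0) |>.exists
  obtain ⟨hk2, hk0⟩ := hk
  have hCk : 2 * (C * L ^ k) ≤ r ^ k := by
    rw [div_pow, le_div_iff₀ (by positivity)] at hk2
    linarith
  set K' : ℝ := max (max 1 ‖(1 : A)‖) K
  have hK1 : 1 ≤ K' := (le_max_left _ _).trans (le_max_left _ _)
  have hK1' : ‖(1 : A)‖ ≤ K' := (le_max_right _ _).trans (le_max_left _ _)
  have hK' : ∀ x ∈ S, ‖x‖ ≤ K' := fun x hx => (hK x hx).trans (le_max_right _ _)
  obtain ⟨G, hG, hb⟩ := exists_norm_prod_le_of_nilpotent (formRadical τ hτ)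
    (isNilpotent_formRadical τ hτ hidem)
    {x | ∃ l : List A, (∀ y ∈ l, y ∈ S) ∧ l.length = k ∧ l.prod = x}
    (a := C * L ^ k) (b := K' ^ (k + 1) + C * L ^ k) (by positivity) (by
      rintro x ⟨l, hl, hlk, rfl⟩
      obtain ⟨y, hy, hyn⟩ := h l hl
      rw [hlk] at hyn
      refine ⟨y, hy, hyn, (norm_sub_le _ _).trans (add_le_add ?_ hyn)⟩
      have := norm_list_prod_le_pow hK1 hK1' l fun x hx => hK' x (hl x hx)
      rwa [hlk] at this)
  refine ⟨G * (K' ^ (k + 1) * max 1 (r⁻¹ ^ k)), fun l hl => ?_⟩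
  obtain ⟨m, t, hmt, hm, ht⟩ := l.exists_flatten_append k hk0
  have hmem : ∀ x ∈ m.map List.prod,
      x ∈ {x | ∃ l : List A, (∀ y ∈ l, y ∈ S) ∧ l.length = k ∧ l.prod = x} := by
    intro x hx
    obtain ⟨b, hbm, rfl⟩ := List.mem_map.1 hx
    refine ⟨b, fun y hy => hl y ?_, hm b hbm, rfl⟩
    rw [hmt]
    exact List.mem_append_left _ (List.mem_flatten.2 ⟨b, hbm, hy⟩)
  have h1 := hb _ hmem t.prod
  have hprod : l.prod = (m.map List.prod).prod * t.prod := by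
    rw [hmt, List.prod_append, List.prod_flatten]
  have htn : ‖t.prod‖ ≤ K' ^ (k + 1) := by
    refine (norm_list_prod_le_pow hK1 hK1' t fun x hx => hK' x (hl x ?_)).trans ?_
    · rw [hmt]; exact List.mem_append_right _ hx
    · exact pow_le_pow_right₀ hK1 (by omega)
  have hlen : l.length = k * m.length + t.length := by
    rw [hmt, List.length_append, List.length_flatten]
    congr 1
    rw [List.eq_replicate_of_mem (l := m.map List.length) (a := k) (by simpa using hm)]
    simp [mul_comm]
  -- For `r < 1` the leftover factor `r ^ t.length` is small and must be compensated.
  have hmax : 1 ≤ max 1 (r⁻¹ ^ k) * r ^ t.length := by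
    rcases le_total 1 r with h1r | h1r
    · exact one_le_mul_of_one_le_of_one_le (le_max_left _ _) (one_le_pow₀ h1r)
    · calc (1 : ℝ) = r⁻¹ ^ k * r ^ k := by rw [← mul_pow, inv_mul_cancel₀ hr0.ne', one_pow]
        _ ≤ max 1 (r⁻¹ ^ k) * r ^ t.length := by
          gcongr ?_ * ?_
          · exact le_max_right _ _
          · exact pow_le_pow_of_le_one hr0.le h1r ht.le
  rw [hprod]
  refine h1.trans ?_
  rw [List.length_map]
  calc G * (2 * (C * L ^ k)) ^ m.length * ‖t.prod‖
      ≤ G * (r ^ k) ^ m.length * K' ^ (k + 1) := by gcongr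
    _ = G * (r ^ k) ^ m.length * K' ^ (k + 1) * 1 := (mul_one _).symm
    _ ≤ G * (r ^ k) ^ m.length * K' ^ (k + 1) * (max 1 (r⁻¹ ^ k) * r ^ t.length) := by gcongr
    _ = G * (K' ^ (k + 1) * max 1 (r⁻¹ ^ k)) * r ^ l.length := by
      rw [hlen, pow_add r, pow_mul r]; ring

/-- If a tracial functional that detects idempotents is `O(L ^ k)` on products of length `k` of
elements of a bounded set, then the norms of these products are `O(r ^ k)` for each `r > L`. -/
theorem exists_norm_prod_le_of_trace_le (τ : A →ₗ[ℝ] ℝ)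
    (hτ : ∀ x y, τ (x * y) = τ (y * x))
    (hidem : ∀ e : A, IsIdempotentElem e → τ e = 0 → e = 0) (S : Set A) {D L K r : ℝ}
    (hL : 0 < L) (hD : 0 ≤ D) (hK : ∀ x ∈ S, ‖x‖ ≤ K)
    (htr : ∀ l : List A, (∀ x ∈ l, x ∈ S) → |τ l.prod| ≤ D * L ^ l.length) (hr : L < r) :
    ∃ G : ℝ, ∀ l : List A, (∀ x ∈ l, x ∈ S) → ‖l.prod‖ ≤ G * r ^ l.length := by
  -- Words in `S` need only span the subalgebra they generate; its idempotents are idempotents of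
  -- `A`.
  let B := Algebra.adjoin ℝ S
  obtain ⟨G, hG⟩ := exists_norm_prod_le_of_adjoin_eq_top (A := B) (τ ∘ₗ B.val.toLinearMap)
    (fun x y => hτ x y)
    (fun e he h => Subtype.ext (hidem e (congrArg Subtype.val he) h))
    (((↑) : B → A) ⁻¹' S) Algebra.adjoin_adjoin_coe_preimage hL hD (fun x hx => hK x hx)
    (fun l hl => by
      have := htr (l.map (↑)) (by
        intro x hx
        obtain ⟨y, hy, rfl⟩ := List.mem_map.1 hx
        exact hl y hy)
      rw [List.length_map] at this
      have hm : ((l.prod : B) : A) = (l.map (↑)).prod := map_list_prod B.val l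
      rwa [← hm] at this) hr
  refine ⟨G, fun l hl => ?_⟩
  have hlB : ∀ x ∈ l, x ∈ B := fun x hx => Algebra.subset_adjoin (hl x hx)
  lift l to List B using hlB
  have := hG l (fun x hx => hl x (List.mem_map.2 ⟨x, hx, rfl⟩))
  rw [List.length_map]
  convert this using 1
  exact congrArg norm (map_list_prod B.val l).symm

end TraceGrowth

/-! ### Comparison of seminorms with entries -/

section EntryBounds

variable {m n : Type*} [Fintype m] [Fintype n]

theorem Seminorm.exists_le_of_entry_le {𝕜 : Type*} [RCLike 𝕜] (N : Seminorm 𝕜 (Matrix m n 𝕜)) :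
    ∃ C : ℝ, 0 < C ∧ ∀ (X : Matrix m n 𝕜) (c : ℝ), 0 ≤ c → (∀ i j, ‖X i j‖ ≤ c) →
      N X ≤ C * c := by
  classical
  refine ⟨∑ i, ∑ j, N (Matrix.single i j 1) + 1, by positivity, fun X c hc hX => ?_⟩
  have h1 : N X ≤ ∑ i, ∑ j, c * N (Matrix.single i j 1) := by
    conv_lhs => rw [Matrix.matrix_eq_sum_single X]
    refine (Finset.le_sum_of_subadditive N (map_zero N).le (map_add_le_add N) _ _).trans (Finset.sum_le_sum fun i _ =>
      (Finset.le_sum_of_subadditive N (map_zero N).le (map_add_le_add N) _ _).trans (Finset.sum_le_sum fun j _ => ?_))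
    have : Matrix.single i j (X i j) = X i j • Matrix.single i j (1 : 𝕜) := by
      rw [Matrix.smul_single, smul_eq_mul, mul_one]
    rw [this, map_smul_eq_mul]
    exact mul_le_mul_of_nonneg_right (hX i j) (apply_nonneg N _)
  refine h1.trans ?_
  simp_rw [← Finset.mul_sum]
  rw [mul_comm, add_mul]
  linarith

theorem Seminorm.exists_abs_le_of_finiteDimensional {V : Type*} [AddCommGroup V] [Module ℝ V]
    [FiniteDimensional ℝ V] (N : Seminorm ℝ V) (hN : ∀ x, N x = 0 → x = 0) (f : V →ₗ[ℝ] ℝ) :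
    ∃ C : ℝ, 0 < C ∧ ∀ x, |f x| ≤ C * N x := by
  let : Norm V := ⟨N⟩
  have core : NormedSpace.Core ℝ V :=
    { norm_nonneg := fun x => apply_nonneg N x
      norm_smul := fun c x => map_smul_eq_mul N c x
      norm_triangle := fun x y => map_add_le_add N x y
      norm_eq_zero_iff := fun x => ⟨hN x, fun h => by subst h; exact map_zero N⟩ }
  let : NormedAddCommGroup V := NormedAddCommGroup.ofCore core
  let : NormedSpace ℝ V := NormedSpace.ofCore core
  let g := LinearMap.toContinuousLinearMap f
  refine ⟨‖g‖ + 1, by positivity, fun x => (g.le_opNorm x).trans ?_⟩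
  have h : ‖x‖ = N x := rfl
  rw [← h]
  have := norm_nonneg x
  linarith

theorem Seminorm.exists_entry_le (N : Seminorm ℝ (Matrix m n ℝ)) (hN : ∀ X, N X = 0 → X = 0) :
    ∃ C : ℝ, 0 < C ∧ ∀ (X : Matrix m n ℝ) i j, |X i j| ≤ C * N X := by
  choose C hC h using fun ij : m × n =>
    N.exists_abs_le_of_finiteDimensional hN (Matrix.entryLinearMap ℝ ℝ ij.1 ij.2)
  refine ⟨∑ ij, C ij + 1, add_pos_of_nonneg_of_pos (Finset.sum_nonneg fun i _ => (hC i).le)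
    one_pos, fun X i j => (h (i, j) X).trans ?_⟩
  refine mul_le_mul_of_nonneg_right ?_ (apply_nonneg N X)
  have := Finset.single_le_sum (fun i _ => (hC i).le) (Finset.mem_univ (i, j))
  linarith

end EntryBounds

/-- Otherwise `(t / r) ^ k` would outgrow `1 / δ`: multiplicative constants vanish under `k`-th
roots. -/
theorem le_of_frequently_mul_pow_le {δ t r : ℝ} (hδ : 0 < δ) (hr : 0 < r)
    (h : ∃ᶠ k : ℕ in atTop, δ * t ^ k ≤ r ^ k) : t ≤ r := by
  by_contra! hlt
  have h1 := (tendsto_pow_atTop_atTop_of_one_lt ((one_lt_div hr).2 hlt)).eventually_gt_atTop (1 / δ)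
  obtain ⟨k, hk, hk1⟩ := (h.and_eventually h1).exists
  rw [div_pow, div_lt_div_iff₀ hδ (by positivity)] at hk1
  linarith

/-! ### Spectral radius, powers and traces -/

section Spectral

attribute [local instance] Matrix.linftyOpNormedRing Matrix.linftyOpNormedAlgebra

theorem matrixSpectralRadius_le_of_pow_entry_le {n : ℕ} (M : Matrix (Fin n) (Fin n) ℝ) {c r : ℝ}
    (hc : 0 ≤ c) (hr : 0 < r) (h : ∀ᶠ k : ℕ in atTop, ∀ i j, |(M ^ k) i j| ≤ c * r ^ k) :
    matrixSpectralRadius M ≤ ENNReal.ofReal r := by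
  obtain ⟨C, hC, hCN⟩ := (normSeminorm ℂ (Matrix (Fin n) (Fin n) ℂ)).exists_le_of_entry_le
  refine iSup₂_le fun z hz => ?_
  rw [← enorm_eq_nnnorm, ← ofReal_norm]
  refine ENNReal.ofReal_le_ofReal ?_
  have hpos : 0 < C * c * ‖(1 : Matrix (Fin n) (Fin n) ℂ)‖ + 1 := by positivity
  refine le_of_frequently_mul_pow_le (inv_pos.2 hpos) hr (Eventually.frequently ?_)
  filter_upwards [h] with k hk
  have hmap : (M.map ((↑) : ℝ → ℂ)) ^ k = (M ^ k).map ((↑) : ℝ → ℂ) :=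
    (map_pow (Complex.ofRealHom.mapMatrix) M k).symm
  have h1 := spectrum.norm_le_norm_mul_of_mem (spectrum.pow_mem_pow _ k hz)
  rw [hmap, norm_pow] at h1
  have h2 := hCN ((M ^ k).map ((↑) : ℝ → ℂ)) (c * r ^ k) (by positivity) fun i j => by
    simpa using hk i j
  rw [inv_mul_le_iff₀ hpos]
  refine h1.trans ((mul_le_mul_of_nonneg_right h2 (norm_nonneg _)).trans ?_)
  have : 0 < r ^ k := by positivity
  nlinarith

theorem abs_trace_pow_le_of_matrixSpectralRadius_le {n : ℕ} (M : Matrix (Fin n) (Fin n) ℝ) {s : ℝ}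
    (hs : 0 ≤ s) (h : matrixSpectralRadius M ≤ ENNReal.ofReal s) (k : ℕ) :
    |(M ^ k).trace| ≤ n * s ^ k := by
  rcases Nat.eq_zero_or_pos k with rfl | hk
  · simp
  have hmap : (M.map ((↑) : ℝ → ℂ)) ^ k = (M ^ k).map ((↑) : ℝ → ℂ) :=
    (map_pow (Complex.ofRealHom.mapMatrix) M k).symm
  have htr : ((M ^ k).trace : ℂ) = ((M.map ((↑) : ℝ → ℂ)) ^ k).trace := by
    rw [hmap]; simp [Matrix.trace]
  have hle : ‖((M ^ k).trace : ℂ)‖ ≤ n * s ^ k := by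
    rw [htr, Matrix.trace_eq_sum_roots_charpoly]
    refine (Multiset.le_sum_of_subadditive norm norm_zero.le norm_add_le _).trans ?_
    refine (Multiset.sum_le_card_nsmul _ (s ^ k) fun x hx => ?_).trans ?_
    · obtain ⟨z, hz, rfl⟩ := Multiset.mem_map.1 hx
      have hz' : z ∈ spectrum ℂ ((M.map ((↑) : ℝ → ℂ)) ^ k) :=
        Matrix.mem_spectrum_of_isRoot_charpoly (Polynomial.isRoot_of_mem_roots hz)
      rw [spectrum.map_pow_of_pos _ hk] at hz'
      obtain ⟨w, hw, rfl⟩ := hz'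
      rw [norm_pow]
      refine pow_le_pow_left₀ (norm_nonneg _) ?_ k
      have := (le_iSup₂ (f := fun (k : ℂ) (_ : k ∈ spectrum ℂ (M.map ((↑) : ℝ → ℂ))) =>
        (‖k‖₊ : ℝ≥0∞)) w hw).trans h
      rw [← enorm_eq_nnnorm, ← ofReal_norm] at this
      exact (ENNReal.ofReal_le_ofReal_iff hs).1 this
    · rw [Multiset.card_map, nsmul_eq_mul]
      gcongr
      refine (Polynomial.card_roots' _).trans ?_
      rw [Matrix.charpoly_natDegree_eq_dim, Fintype.card_fin]
  simpa using hle

/-- In characteristic zero the trace of an idempotent determines its rank. -/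
theorem Matrix.eq_zero_of_isIdempotentElem_of_trace_eq_zero {n : Type*} [Fintype n]
    [DecidableEq n] {K : Type*} [Field K] [CharZero K] {e : Matrix n n K}
    (he : IsIdempotentElem e) (h : e.trace = 0) : e = 0 := by
  have h1 : IsIdempotentElem (Matrix.toLin' e) := by
    have := he.map (Matrix.toLinAlgEquiv' : Matrix n n K ≃ₐ[K] _)
    exact this
  have h2 := (LinearMap.IsIdempotentElem.trace_eq_zero_iff h1).1 (by rw [trace_toLin'_eq, h])
  exact (LinearEquiv.map_eq_zero_iff _).1 h2

variable {d : ℕ}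

/-- The norms of products of matrices are controlled by their traces. -/
theorem exists_seminorm_prod_le_of_trace_le (N : Seminorm ℝ (Matrix (Fin d) (Fin d) ℝ))
    (S : Set (Matrix (Fin d) (Fin d) ℝ)) {D L K r : ℝ} (hL : 0 < L) (hD : 0 ≤ D) (hK0 : 0 ≤ K)
    (hK : ∀ X ∈ S, ∀ i j, |X i j| ≤ K)
    (htr : ∀ l : List (Matrix (Fin d) (Fin d) ℝ), (∀ x ∈ l, x ∈ S) →
      |l.prod.trace| ≤ D * L ^ l.length) (hr : L < r) :
    ∃ G : ℝ, ∀ l : List (Matrix (Fin d) (Fin d) ℝ), (∀ x ∈ l, x ∈ S) →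
      N l.prod ≤ G * r ^ l.length := by
  obtain ⟨C₁, hC₁, h₁⟩ := (normSeminorm ℝ (Matrix (Fin d) (Fin d) ℝ)).exists_le_of_entry_le
  obtain ⟨C₂, hC₂, h₂⟩ := (normSeminorm ℝ (Matrix (Fin d) (Fin d) ℝ)).exists_entry_le
    fun X hX => norm_eq_zero.1 hX
  obtain ⟨C₃, hC₃, h₃⟩ := N.exists_le_of_entry_le
  obtain ⟨G, hG⟩ := exists_norm_prod_le_of_trace_le
    (Matrix.traceLinearMap (Fin d) ℝ ℝ) (fun x y => Matrix.trace_mul_comm x y)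
    (fun e he h => Matrix.eq_zero_of_isIdempotentElem_of_trace_eq_zero he h) S hL hD
    (fun x hx => h₁ x K hK0 (hK x hx)) htr hr
  refine ⟨C₃ * (C₂ * G), fun l hl => ?_⟩
  have h4 := h₃ l.prod (C₂ * ‖l.prod‖) (by positivity) (h₂ l.prod)
  refine h4.trans ?_
  rw [mul_assoc, mul_assoc]
  gcongr
  exact hG l hl

/-- Submultiplicativity gives a crude rate, enough for finiteness of the joint spectral radius. -/
theorem exists_seminorm_prod_le (N : Seminorm ℝ (Matrix (Fin d) (Fin d) ℝ))
    (S : Set (Matrix (Fin d) (Fin d) ℝ)) {K : ℝ} (hK0 : 0 ≤ K)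
    (hK : ∀ X ∈ S, ∀ i j, |X i j| ≤ K) :
    ∃ G r : ℝ, 0 < r ∧ ∀ l : List (Matrix (Fin d) (Fin d) ℝ), (∀ x ∈ l, x ∈ S) →
      N l.prod ≤ G * r ^ l.length := by
  obtain ⟨C₁, hC₁, h₁⟩ := (normSeminorm ℝ (Matrix (Fin d) (Fin d) ℝ)).exists_le_of_entry_le
  obtain ⟨C₂, hC₂, h₂⟩ := (normSeminorm ℝ (Matrix (Fin d) (Fin d) ℝ)).exists_entry_le
    fun X hX => norm_eq_zero.1 hX
  obtain ⟨C₃, hC₃, h₃⟩ := N.exists_le_of_entry_le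
  set r := max (max 1 ‖(1 : Matrix (Fin d) (Fin d) ℝ)‖) (C₁ * K)
  have hr : 1 ≤ r := (le_max_left _ _).trans (le_max_left _ _)
  refine ⟨C₃ * (C₂ * r), r, by positivity, fun l hl => ?_⟩
  have h4 := h₃ l.prod (C₂ * ‖l.prod‖) (by positivity) (h₂ l.prod)
  refine h4.trans ?_
  have h5 := norm_list_prod_le_pow hr ((le_max_right _ _).trans (le_max_left _ _)) l
    fun x hx => (h₁ x K hK0 (hK x (hl x hx))).trans (le_max_right _ _)
  rw [pow_succ'] at h5
  rw [mul_assoc, mul_assoc]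
  gcongr

end Spectral

/-! ### Joint spectral radius and growth rates -/

section JointSpectralRadius

variable {d : ℕ} {N : Seminorm ℝ (Matrix (Fin d) (Fin d) ℝ)}
  {S : Set (Matrix (Fin d) (Fin d) ℝ)}

theorem jointSpectralRadius_le_of_seminorm_prod_le {G r : ℝ} (hr : 0 < r)
    (h : ∀ l : List (Matrix (Fin d) (Fin d) ℝ), (∀ x ∈ l, x ∈ S) →
      N l.prod ≤ G * r ^ l.length) : jointSpectralRadius N S ≤ ENNReal.ofReal r := by
  -- `G` may be nonpositive; `G' ^ (1 / k) → 1` needs a positive base.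
  set G' := max G 1
  have hG' : 0 < G' := by positivity
  have hlim : Tendsto (fun k : ℕ => ENNReal.ofReal (G' ^ (1 / (k : ℝ)) * r)) atTop
      (nhds (ENNReal.ofReal r)) := by
    apply ENNReal.tendsto_ofReal
    have h0 : Tendsto (fun k : ℕ => G' ^ (1 / (k : ℝ))) atTop (nhds (G' ^ (0 : ℝ))) :=
      ((Real.continuous_const_rpow hG'.ne').tendsto 0).comp tendsto_one_div_atTop_nhds_zero_nat
    simpa using h0.mul_const r
  rw [← hlim.limsup_eq]
  refine limsup_le_limsup ?_
  filter_upwards [eventually_gt_atTop 0] with k hk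
  refine iSup₂_le fun A hA => ?_
  have hk' : (k : ℝ) ≠ 0 := by positivity
  have h1 := h (List.ofFn A) (by simpa [List.mem_ofFn] using hA)
  rw [List.length_ofFn] at h1
  have h2 : N (List.ofFn A).prod ≤ G' * r ^ k :=
    h1.trans (mul_le_mul_of_nonneg_right (le_max_left _ _) (by positivity))
  rw [ENNReal.ofReal_rpow_of_nonneg (apply_nonneg N _) (by positivity)]
  refine ENNReal.ofReal_le_ofReal ?_
  refine (Real.rpow_le_rpow (apply_nonneg N _) h2 (by positivity)).trans_eq ?_
  rw [Real.mul_rpow hG'.le (by positivity), ← Real.rpow_natCast r k, ← Real.rpow_mul hr.le,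
    mul_one_div_cancel hk', Real.rpow_one]

theorem eventually_seminorm_prod_le_of_jointSpectralRadius_lt {r : ℝ}
    (h : jointSpectralRadius N S < ENNReal.ofReal r) :
    ∀ᶠ k : ℕ in atTop, ∀ A : Fin k → Matrix (Fin d) (Fin d) ℝ, (∀ i, A i ∈ S) →
      N (List.ofFn A).prod ≤ r ^ k := by
  have hr : 0 < r := ENNReal.ofReal_pos.1 (bot_le.trans_lt h)
  filter_upwards [eventually_lt_of_limsup_lt h, eventually_gt_atTop 0] with k hk hk0 A hA
  have h1 := (le_iSup₂ (f := fun (A : Fin k → Matrix (Fin d) (Fin d) ℝ) (_ : ∀ i, A i ∈ S) =>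
    ENNReal.ofReal (N (List.ofFn A).prod) ^ (1 / (k : ℝ))) A hA).trans hk.le
  rw [ENNReal.ofReal_rpow_of_nonneg (apply_nonneg N _) (by positivity),
    ENNReal.ofReal_le_ofReal_iff hr.le] at h1
  have h2 := pow_le_pow_left₀ (Real.rpow_nonneg (apply_nonneg N _) _) h1 k
  rwa [one_div, Real.rpow_inv_natCast_pow (apply_nonneg N _) hk0.ne'] at h2

end JointSpectralRadius

/-! ### Algebra of Kronecker powers -/

section KroneckerPower

variable {d : ℕ}

theorem kronPow_one (p : ℕ) : kronPow (1 : Matrix (Fin d) (Fin d) ℝ) p = 1 := by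
  induction p with
  | zero => rfl
  | succ p ih => rw [kronPow, ih, Matrix.one_kronecker_one, Matrix.reindex_apply,
      Matrix.submatrix_one_equiv]

theorem kronPow_mul (X Y : Matrix (Fin d) (Fin d) ℝ) (p : ℕ) :
    kronPow (X * Y) p = kronPow X p * kronPow Y p := by
  induction p with
  | zero => exact (one_mul 1).symm
  | succ p ih =>
    simp only [kronPow, ih, Matrix.mul_kronecker_mul, Matrix.reindex_apply,
      Matrix.submatrix_mul_equiv]

theorem trace_kronPow (X : Matrix (Fin d) (Fin d) ℝ) (p : ℕ) :
    (kronPow X p).trace = X.trace ^ p := by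
  induction p with
  | zero =>
    rw [kronPow, pow_zero]
    exact (Matrix.trace_one (n := Fin 1)).trans (by simp)
  | succ p ih =>
    rw [pow_succ X.trace, ← ih, ← Matrix.trace_kronecker, kronPow, Matrix.reindex_apply]
    exact Equiv.sum_comp _ (fun i => (kronPow X p ⊗ₖ X) i i)

theorem abs_kronPow_apply_le {X : Matrix (Fin d) (Fin d) ℝ} {c : ℝ} (hX : ∀ i j, |X i j| ≤ c)
    (p : ℕ) (i j : Fin (d ^ p)) : |kronPow X p i j| ≤ c ^ p := by
  induction p with
  | zero =>
    rw [kronPow, Subsingleton.elim (α := Fin 1) i j, Matrix.one_apply_eq]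
    simp
  | succ p ih =>
    rw [kronPow, Matrix.reindex_apply, Matrix.submatrix_apply, Matrix.kronecker_apply, abs_mul,
      pow_succ c]
    refine mul_le_mul (ih _ _) (hX _ _) (abs_nonneg _) ?_
    -- The index `a` supplies an entry whose absolute value is at most `c ^ p`, so `c ^ p` is
    -- nonnegative.
    let a := (finProdFinEquiv.symm (finCongr (pow_succ d p) i)).1
    exact (abs_nonneg _).trans (ih a a)

theorem continuous_kronPow (p : ℕ) :
    Continuous fun X : Matrix (Fin d) (Fin d) ℝ => kronPow X p := by
  induction p with
  | zero => exact continuous_const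
  | succ p ih =>
    refine continuous_matrix fun i j => ?_
    simp only [kronPow, Matrix.reindex_apply, Matrix.submatrix_apply]
    exact (ih.matrix_elem _ _).mul (continuous_id.matrix_elem _ _)

end KroneckerPower

/-! ### Moments of random products -/

section Expectation

variable {d : ℕ} (μ : Measure (Matrix (Fin d) (Fin d) ℝ))

instance matrixSecondCountableTopology (d : ℕ) :
    SecondCountableTopology (Matrix (Fin d) (Fin d) ℝ) :=
  inferInstanceAs (SecondCountableTopology (Fin d → Fin d → ℝ))

theorem ae_mem_support : ∀ᵐ A ∂μ, A ∈ μ.support := Measure.support_mem_ae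

theorem integrable_kronPow_apply [IsFiniteMeasure μ] (hsupp : IsCompact μ.support) (p : ℕ)
    (i j : Fin (d ^ p)) : Integrable (fun A => kronPow A p i j) μ := by
  rw [← Measure.restrict_eq_self_of_ae_mem (ae_mem_support μ)]
  exact ContinuousOn.integrableOn_compact' hsupp Measure.isClosed_support.measurableSet
    ((continuous_kronPow p).matrix_elem i j).continuousOn

variable [IsProbabilityMeasure μ]

theorem ae_pi_mem_support (k : ℕ) :
    ∀ᵐ A ∂Measure.pi fun _ : Fin k => μ, ∀ i, A i ∈ μ.support :=
  eventually_all.2 fun i =>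
    (Measure.tendsto_eval_ae_ae (μ := fun _ : Fin k => μ) (i := i)).eventually (ae_mem_support μ)

/-- By independence, `E[(A₁ ⋯ A_k)^{⊗p}] = E[A^{⊗p}]^k`. -/
theorem integral_kronPow_prod (hsupp : IsCompact μ.support) (p k : ℕ) (i j : Fin (d ^ p)) :
    Integrable (fun A : Fin k → Matrix (Fin d) (Fin d) ℝ => kronPow (List.ofFn A).prod p i j)
        (Measure.pi fun _ => μ) ∧
      ∫ A : Fin k → Matrix (Fin d) (Fin d) ℝ, kronPow (List.ofFn A).prod p i j
        ∂Measure.pi (fun _ => μ) = (expKronPow μ p ^ k) i j := by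
  induction k generalizing i j with
  | zero => simp [kronPow_one]
  | succ k ih =>
    have he := measurePreserving_piFinSuccAbove (fun _ : Fin (k + 1) => μ) 0
    let F : Fin (d ^ p) → Matrix (Fin d) (Fin d) ℝ × (Fin k → Matrix (Fin d) (Fin d) ℝ) → ℝ :=
      fun l z => kronPow z.1 p i l * kronPow (List.ofFn z.2).prod p l j
    have hfun : (fun A : Fin (k + 1) → Matrix (Fin d) (Fin d) ℝ =>
        kronPow (List.ofFn A).prod p i j) = fun A => (fun z => ∑ l, F l z)
          (MeasurableEquiv.piFinSuccAbove (fun _ => Matrix (Fin d) (Fin d) ℝ) 0 A) := by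
      funext A
      rw [List.ofFn_succ, List.prod_cons, kronPow_mul, Matrix.mul_apply]
      rfl
    have hF : ∀ l, Integrable (F l) (μ.prod (Measure.pi fun _ : Fin k => μ)) := fun l =>
      (integrable_kronPow_apply μ hsupp p i l).mul_prod (ih l j).1
    rw [hfun]
    refine ⟨(he.integrable_comp_emb (MeasurableEquiv.measurableEmbedding _)).2
      (integrable_finsetSum _ fun l _ => hF l), ?_⟩
    rw [he.integral_comp' (fun z => ∑ l, F l z), integral_finsetSum _ fun l _ => hF l, pow_succ',
      Matrix.mul_apply]
    refine Finset.sum_congr rfl fun l _ => ?_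
    rw [← (ih l j).2]
    exact integral_prod_mul (μ := μ) (ν := Measure.pi fun _ : Fin k => μ)
      (fun A => kronPow A p i l)
      fun A : Fin k → Matrix (Fin d) (Fin d) ℝ => kronPow (List.ofFn A).prod p l j

theorem integral_trace_prod_pow (hsupp : IsCompact μ.support) (p k : ℕ) :
    Integrable (fun A : Fin k → Matrix (Fin d) (Fin d) ℝ => (List.ofFn A).prod.trace ^ p)
        (Measure.pi fun _ => μ) ∧
      ∫ A : Fin k → Matrix (Fin d) (Fin d) ℝ, (List.ofFn A).prod.trace ^ p
        ∂Measure.pi (fun _ => μ) = (expKronPow μ p ^ k).trace := by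
  simp_rw [← trace_kronPow, Matrix.trace, Matrix.diag_apply]
  refine ⟨integrable_finsetSum _ fun i _ => (integral_kronPow_prod μ hsupp p k i i).1, ?_⟩
  rw [integral_finsetSum _ fun i _ => (integral_kronPow_prod μ hsupp p k i i).1]
  exact Finset.sum_congr rfl fun i _ => (integral_kronPow_prod μ hsupp p k i i).2

theorem continuous_list_ofFn_prod (k : ℕ) :
    Continuous fun A : Fin k → Matrix (Fin d) (Fin d) ℝ => (List.ofFn A).prod := by
  simp_rw [List.ofFn_eq_map]
  exact continuous_list_prod _ fun i _ => continuous_apply i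

/-- An open box around `A` has as measure a product of positive factors. This turns bounds on
moments into pointwise bounds on the support. -/
theorem measure_pi_pos_of_mem_support {k : ℕ} {A : Fin k → Matrix (Fin d) (Fin d) ℝ}
    (hA : ∀ i, A i ∈ μ.support) {U : Set (Fin k → Matrix (Fin d) (Fin d) ℝ)} (hU : IsOpen U)
    (hAU : A ∈ U) : 0 < Measure.pi (fun _ => μ) U := by
  obtain ⟨u, hu, hsub⟩ := isOpen_pi_iff'.1 hU A hAU
  refine lt_of_lt_of_le ?_ (measure_mono hsub)
  rw [Measure.pi_pi]
  exact pos_iff_ne_zero.2 (Finset.prod_ne_zero_iff.2 fun i _ =>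
    ((Measure.mem_support_iff_forall _).1 (hA i) _ ((hu i).1.mem_nhds (hu i).2)).ne')

/-- The even moments of the trace of a product bound its values on the support. -/
theorem abs_trace_prod_le (hsupp : IsCompact μ.support) {q : ℝ} (hq : 0 < q)
    (h : ∀ᶠ p : ℕ in atTop, matrixSpectralRadius (expKronPow μ p) ≤ ENNReal.ofReal (q ^ p))
    {k : ℕ} {A : Fin k → Matrix (Fin d) (Fin d) ℝ} (hA : ∀ i, A i ∈ μ.support) :
    |(List.ofFn A).prod.trace| ≤ (d + 1) * q ^ k := by
  refine le_of_forall_lt fun t ht => ?_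
  rcases lt_or_ge t 0 with ht0 | ht0
  · exact ht0.trans (by positivity)
  obtain ⟨t', htt', ht'⟩ := exists_between ht
  refine htt'.trans_le ?_
  let U : Set (Fin k → Matrix (Fin d) (Fin d) ℝ) := {B | t' < |(List.ofFn B).prod.trace|}
  have hU : IsOpen U :=
    isOpen_lt continuous_const (continuous_list_ofFn_prod k).matrix_trace.abs
  have hpos := measure_pi_pos_of_mem_support μ hA hU ht'
  set ν : Measure (Fin k → Matrix (Fin d) (Fin d) ℝ) := Measure.pi fun _ => μ
  have hδ : 0 < ν.real U := ENNReal.toReal_pos hpos.ne' (measure_ne_top _ _)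
  -- Markov's inequality on `U`, then `p`-th roots along even `p`, for which the integrand is
  -- nonnegative. The constant `d + 1` keeps the bound positive when `d = 0`.
  refine le_of_frequently_mul_pow_le hδ (by positivity) ?_
  have heven : ∃ᶠ p : ℕ in atTop, Even p := frequently_atTop.2 fun a => ⟨2 * a, by omega, by simp⟩
  refine (heven.and_eventually h).mono fun p ⟨hp, hs⟩ => ?_
  obtain ⟨hint, heq⟩ := integral_trace_prod_pow μ hsupp p k
  have h1 : t' ^ p * ν.real U ≤ (expKronPow μ p ^ k).trace := by
    rw [← heq]
    refine le_trans ?_ (mul_meas_ge_le_integral_of_nonneg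
      (Eventually.of_forall fun B => hp.pow_nonneg _) hint (t' ^ p))
    refine mul_le_mul_of_nonneg_left (measureReal_mono fun B hB => ?_) (hp.pow_nonneg _)
    have : t' ^ p ≤ |(List.ofFn B).prod.trace| ^ p :=
      pow_le_pow_left₀ (ht0.trans htt'.le) (le_of_lt hB) p
    rwa [hp.pow_abs] at this
  have h2 := abs_trace_pow_le_of_matrixSpectralRadius_le (expKronPow μ p) (by positivity) hs k
  rw [mul_comm]
  refine h1.trans ((le_abs_self _).trans (h2.trans ?_))
  push_cast
  rw [mul_pow, pow_right_comm]
  gcongr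
  linarith

/-- For large `k` the integrand of `E[(A₁⋯A_k)^{⊗p}]` has entries at most `(C * r ^ k) ^ p` almost
surely; with `p` fixed, `C ^ p` is a harmless constant as `k → ∞`. -/
theorem matrixSpectralRadius_expKronPow_le {N : Seminorm ℝ (Matrix (Fin d) (Fin d) ℝ)}
    (hN : ∀ A, N A = 0 → A = 0) (hsupp : IsCompact μ.support) {r : ℝ}
    (h : jointSpectralRadius N μ.support < ENNReal.ofReal r) (p : ℕ) :
    matrixSpectralRadius (expKronPow μ p) ≤ ENNReal.ofReal (r ^ p) := by
  have hr : 0 < r := ENNReal.ofReal_pos.1 (bot_le.trans_lt h)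
  obtain ⟨C, hC, hCN⟩ := N.exists_entry_le hN
  refine matrixSpectralRadius_le_of_pow_entry_le _ (c := C ^ p) (by positivity) (by positivity) ?_
  filter_upwards [eventually_seminorm_prod_le_of_jointSpectralRadius_lt h] with k hk i j
  rw [← (integral_kronPow_prod μ hsupp p k i j).2, ← Real.norm_eq_abs]
  refine (norm_integral_le_of_norm_le_const (C := C ^ p * (r ^ p) ^ k) ?_).trans_eq (by simp)
  filter_upwards [ae_pi_mem_support μ k] with A hA
  have := abs_kronPow_apply_le (c := C * r ^ k)
    (fun i j => (hCN (List.ofFn A).prod i j).trans (by gcongr; exact hk A hA)) p i j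
  rwa [mul_pow, pow_right_comm] at this

end Expectation

theorem theorem3 (d : ℕ) (μ : Measure (Matrix (Fin d) (Fin d) ℝ)) [IsProbabilityMeasure μ]
    (hsupp : IsCompact μ.support)
    (hsing : ∃ (n : ℕ) (c : Fin n → ℝ≥0) (M : Fin n → Matrix (Fin d) (Fin d) ℝ),
      (∀ i, 0 < c i) ∧ μ.singularPart volume = ∑ i, c i • Measure.dirac (M i))
    (N : Seminorm ℝ (Matrix (Fin d) (Fin d) ℝ)) (hN : ∀ A, N A = 0 → A = 0) :
    (∀ (p : ℕ) (i j : Fin (d ^ p)), Integrable (fun A => kronPow A p i j) μ) ∧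
    jointSpectralRadius N μ.support ≠ ∞ ∧
    jointSpectralRadius N μ.support =
      limsup (fun p : ℕ => matrixSpectralRadius (expKronPow μ p) ^ (1 / (p : ℝ))) atTop := by
  obtain ⟨K, hK0, hK⟩ : ∃ K : ℝ, 0 ≤ K ∧ ∀ X ∈ μ.support, ∀ i j, |X i j| ≤ K := by
    choose K hK using fun ij : Fin d × Fin d =>
      hsupp.exists_bound_of_continuousOn (f := fun X => X ij.1 ij.2)
        (continuous_id.matrix_elem ij.1 ij.2).continuousOn
    refine ⟨∑ ij, |K ij|, by positivity, fun X hX i j => (hK (i, j) X hX).trans ?_⟩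
    exact (le_abs_self _).trans
      (Finset.single_le_sum (fun ij _ => abs_nonneg (K ij)) (Finset.mem_univ (i, j)))
  refine ⟨integrable_kronPow_apply μ hsupp, ?_, le_antisymm ?_ ?_⟩
  · obtain ⟨G, r, hr, h⟩ := exists_seminorm_prod_le N μ.support hK0 hK
    exact ((jointSpectralRadius_le_of_seminorm_prod_le hr h).trans_lt ENNReal.ofReal_lt_top).ne
  · refine le_of_forall_gt_imp_ge_of_dense fun a ha => ?_
    -- Two intermediate rates are needed: `q` bounds the traces, and norms are controlled only at a
    -- strictly larger rate `r`.
    obtain ⟨q, hLq, hqa⟩ := ENNReal.lt_iff_exists_nnreal_btwn.1 ha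
    obtain ⟨r, hqr, hra⟩ := ENNReal.lt_iff_exists_nnreal_btwn.1 hqa
    have hq : 0 < (q : ℝ) := 
      NNReal.coe_pos.2 (ENNReal.coe_pos.1 (bot_le.trans_lt hLq))
    have hqr' : (q : ℝ) < r := by exact_mod_cast hqr
    have hev : ∀ᶠ p : ℕ in atTop,
        matrixSpectralRadius (expKronPow μ p) ≤ ENNReal.ofReal ((q : ℝ) ^ p) := by
      filter_upwards [eventually_lt_of_limsup_lt hLq, eventually_gt_atTop 0] with p hp hp0
      rw [one_div, ENNReal.rpow_inv_lt_iff (by positivity), ENNReal.rpow_natCast] at hp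
      rw [ENNReal.ofReal_pow hq.le, ENNReal.ofReal_coe_nnreal]
      exact hp.le
    obtain ⟨G, hG⟩ := exists_seminorm_prod_le_of_trace_le N μ.support (D := d + 1) hq
      (by positivity) hK0 hK (fun l hl => by
        have := abs_trace_prod_le μ hsupp hq hev (k := l.length) (A := l.get)
          fun i => hl _ (l.get_mem i)
        rwa [List.ofFn_get] at this) hqr'
    refine (jointSpectralRadius_le_of_seminorm_prod_le (hq.trans hqr') hG).trans ?_
    rw [ENNReal.ofReal_coe_nnreal]
    exact hra.le
  · refine le_of_forall_gt_imp_ge_of_dense fun a ha => ?_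
    obtain ⟨r, hr, hra⟩ := ENNReal.lt_iff_exists_nnreal_btwn.1 ha
    refine le_trans (limsup_le_of_le (by isBoundedDefault) ?_) hra.le
    filter_upwards [eventually_gt_atTop 0] with p hp0
    rw [one_div, ENNReal.rpow_inv_le_iff (by positivity), ENNReal.rpow_natCast]
    rw [← ENNReal.ofReal_coe_nnreal] at hr ⊢
    refine (matrixSpectralRadius_expKronPow_le μ hN hsupp hr p).trans_eq ?_
    exact ENNReal.ofReal_pow r.2 p
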